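/- Algorithm 1 takes a finite tree $T$ and a graph $G$ in which every vertex has finitely many neighbours. It chooses an arbitrary root $r\in V(T)$ and embeds it at an arbitrary vertex $f(r)\in V(G)$. The parent of a vertex $x\neq r$ of $T$ is the neighbour of $x$ on the path from $r$ to $x$, and the other neighbours of $x$ are its children (all neighbours of $r$ are its children). As long as $T$ is not completely embedded, the algorithm takes an arbitrary vertex $x\in V(T)$ that is already embedded but whose children are not (this choice may depend on the past of the run). If $f(x)$ has at least as many neighbours in $G$ that are unoccupied by vertices of $T$ as $x$ has children, the children of $x$ are placed at distinct unoccupied neighbours of $f(x)$ chosen uniformly at random (a uniformly random injection), and the algorithm continues; otherwise it fails. **Theorem 2.1.** Let $\varepsilon\le 1/8$ be a fixed real number. For every $\eta>0$ there is $d_0=d_0(\varepsilon,\eta)$ such that for every integer $d\ge d_0$ the following holds. Let $G$ be a graph with all degrees finite, with minimum degree at least $d$, and containing no cycle of length $4$ as a (not necessarily induced) subgraph. Let $T$ be a finite tree of size $|T|\le\varepsilon d^2$, where size is the number of edges (in particular, $T$ may be any tree with at most $\varepsilon d^2$ vertices), and of maximum degree at most $d-2\varepsilon d-2$. Then, whatever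 the arbitrary choices (of the root $r$, of the vertex $f(r)$, and of the next vertex to process), with probability at least $1-\eta$ Algorithm 1 finds an embedding of $T$ in $G$, i.e. an injective map $V(T)\to V(G)$ that maps edges of $T$ to edges of $G$. -/

import Mathlib

namespace TreeEmbedding

universe u v

variable {U : Type u} {V : Type v}

/-- In the tree `T` rooted at `r`, `p` is the parent of `c`: it is the neighbour of `c` on the
path from `r` to `c`. -/
def IsParent (T : SimpleGraph U) (r p c : U) : Prop :=
  T.Adj c p ∧ ∃ w : T.Walk r c, w.IsPath ∧ p ∈ w.support

open Classical in
/-- The children of `x` in the tree `T` rooted at `r`. -/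
noncomputable def children [Fintype U] (T : SimpleGraph U) (r x : U) : Finset U :=
  Finset.univ.filter fun c => IsParent T r x c

/-- A partial embedding: `f x = some a` if the tree vertex `x` has been placed at the vertex `a`
of the host graph, `f x = none` if `x` has not been embedded yet. -/
abbrev PartialEmb (U : Type u) (V : Type v) := U → Option V

/-- The tree vertices that are already embedded but whose children are not. -/
def pending [Fintype U] (T : SimpleGraph U) (r : U) (f : PartialEmb U V) : Set U :=
  {x | f x ≠ none ∧ ∃ c ∈ children T r x, f c = none}

/-- The way in which the algorithm makes its arbitrary choice of the next vertex `x` to be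
processed. The choice may depend on the whole history of the run: `next past f` is the vertex
selected when the current partial embedding is `f` and the earlier ones are listed in `past`
(latest first). -/
structure SelectionRule [Fintype U] (T : SimpleGraph U) (r : U) (V : Type v) where
  next : List (PartialEmb U V) → PartialEmb U V → U
  next_mem : ∀ past f, (pending T r f).Nonempty → next past f ∈ pending T r f

open Classical in
/-- The neighbours of `a` in the host graph that are not occupied by vertices of the tree. -/
noncomputable def available (G : SimpleGraph V) [G.LocallyFinite] (f : PartialEmb U V) (a : V) :
    Finset V :=
  (G.neighborFinset a).filter fun b => ∀ x, f x ≠ some b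

open Classical in
/-- Extend `f` by placing the vertices of `C` at the vertices prescribed by `g`. -/
noncomputable def place (f : PartialEmb U V) (C : Finset U) {A : Finset V} (g : C ↪ A) :
    PartialEmb U V :=
  fun x => if h : x ∈ C then some (g ⟨x, h⟩ : V) else f x

/-- The uniform distribution on the injections of `C` into `A`, if there are at least as many
elements in `A` as in `C`. -/
noncomputable def uniformInjection (C : Finset U) (A : Finset V) (h : C.card ≤ A.card) :
    PMF (C ↪ A) := by
  classical
  exact
    haveI : Nonempty (C ↪ A) := Function.Embedding.nonempty_of_card_le (by simpa using h)
    PMF.uniformOfFintype (C ↪ A)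

/-- One step of the algorithm: process the embedded tree vertex `x`. If its image has enough
unoccupied neighbours, the children of `x` are placed at distinct unoccupied neighbours chosen
uniformly at random; otherwise the algorithm fails (outcome `none`). -/
noncomputable def step [Fintype U] (G : SimpleGraph V) [G.LocallyFinite] (T : SimpleGraph U)
    (r : U) (f : PartialEmb U V) (x : U) : PMF (Option (PartialEmb U V)) :=
  match f x with
  | none => PMF.pure none
  | some a =>
    if h : (children T r x).card ≤ (available G f a).card then
      (uniformInjection (children T r x) (available G f a) h).map
        fun g => some (place f (children T r x) g)
    else PMF.pure none

open Classical in
/-- The random outcome of at most `n` further steps from the current partial embedding `f`, with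
earlier partial embeddings `past`. The run stops when it fails or the whole tree is embedded. -/
noncomputable def run [Fintype U] (G : SimpleGraph V) [G.LocallyFinite] (T : SimpleGraph U)
    (r : U) (σ : SelectionRule T r V) :
    ℕ → List (PartialEmb U V) → PartialEmb U V → PMF (Option (PartialEmb U V))
  | 0, _, f => PMF.pure (some f)
  | n + 1, past, f =>
    if ∀ x, f x ≠ none then PMF.pure (some f)
    else (step G T r f (σ.next past f)).bind fun o =>
      match o with
      | none => PMF.pure none
      | some f' => run G T r σ n (f :: past) f'

open Classical in
/-- The randomized embedding algorithm with root `r` embedded at `a`, and with the selection rule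
`σ`. Every step embeds at least one new vertex, so as many steps as there are vertices in the tree
are enough for a complete run. -/
noncomputable def algorithm [Fintype U] (G : SimpleGraph V) [G.LocallyFinite] (T : SimpleGraph U)
    (r : U) (a : V) (σ : SelectionRule T r V) : PMF (Option (PartialEmb U V)) :=
  run G T r σ (Fintype.card U) [] fun x => if x = r then some a else none

/-- The outcomes in which the algorithm has found an embedding of `T` in `G`, that is, an injective
map defined on all vertices of `T` that sends edges of `T` to edges of `G`. -/
def success (G : SimpleGraph V) (T : SimpleGraph U) : Set (Option (PartialEmb U V)) :=
  {o | ∃ φ : T.Copy G, o = some fun x => some (φ x)}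

end TreeEmbedding

/-! The load of a host vertex is the number of its occupied neighbours. Put `K = 2εd + 2` and `D = d
- K`, so that no tree vertex has more than `D` children. A step at `a` can fail only if the load of
`a` has reached `K`, because otherwise more than `D` neighbours of `a` are free. So it suffices that
no vertex still awaiting its children has load `K` or more.

Without 4-cycles, a vertex `v ≠ a` has at most one neighbour among those of `a`. Placing a set `C`
of children around `a` therefore raises the load of `v` by at most 1, with probability at most `|C|
/ D` (`card_hit_mul_le`). Hence `exp (l * load)` grows in expectation by a factor of at most `exp (θ
* |C|)`, where `θ = (exp l - 1) / D`, and weighting by `exp (θ * numUnembedded)` cancels this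
growth.

The host graph may be infinite, so there is no union bound over all its vertices. Only vertices of
load at least 2 are tracked. Each is determined by a pair of its occupied neighbours, so with `n =
|U|` there are at most `n² - n` (`card_crowd_le`), and the cost of entering the crowd is prepaid in
`potential`. The potential is a supermartingale (`sum_potential_place_le`) and is at least 1 when
failure threatens, so its initial value bounds the failure probability. With `l = 1/2` this value is
at most `2 d⁴ exp (-εd/20)`. -/

namespace TreeEmbedding

universe u v

variable {U : Type u} {V : Type v}

/-! ### Parents and children in a rooted tree. -/

section Tree

variable {T : SimpleGraph U} {r : U}

theorem not_isParent_root (p : U) : ¬ IsParent T r p r := by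
  rintro ⟨hadj, w, hw, hp⟩
  rw [(SimpleGraph.Walk.isPath_iff_nil.mp hw).eq_nil] at hp
  simp only [SimpleGraph.Walk.support_nil, List.mem_singleton] at hp
  exact hadj.ne hp.symm

theorem IsParent.unique (hT : T.IsTree) {p q c : U} (hp : IsParent T r p c)
    (hq : IsParent T r q c) : p = q := by
  obtain ⟨hpc, w, hw, hpw⟩ := hp
  obtain ⟨hqc, w', hw', hqw⟩ := hq
  obtain rfl : w = w' := (hT.existsUnique_path r c).unique hw hw'
  rw [hT.isAcyclic.eq_penultimate_of_adj_end hw hpc hpw,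
    hT.isAcyclic.eq_penultimate_of_adj_end hw hqc hqw]

theorem isParent_or_isParent (hT : T.IsTree) {x y : U} (h : T.Adj x y) :
    IsParent T r x y ∨ IsParent T r y x := by
  obtain ⟨w, hw, -⟩ := hT.existsUnique_path r x
  by_cases hy : y ∈ w.support
  · exact Or.inr ⟨h, w, hw, hy⟩
  · exact Or.inl ⟨h.symm, w.concat h, hw.concat hy h,
      w.support_subset_support_concat h w.end_mem_support⟩

variable [Fintype U]

theorem mem_children {x c : U} : c ∈ children T r x ↔ IsParent T r x c := by
  simp [children]

theorem card_children_le_maxDegree [DecidableRel T.Adj] (x : U) :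
    (children T r x).card ≤ T.maxDegree := by
  refine le_trans (Finset.card_le_card fun c hc => ?_) (T.degree_le_maxDegree x)
  rw [SimpleGraph.mem_neighborFinset]
  exact (mem_children.mp hc).1.symm

end Tree

/-! ### Invariants of a run. -/

/-- The properties shared by all partial embeddings that occur in a run of the algorithm. -/
structure Valid (G : SimpleGraph V) (T : SimpleGraph U) (r : U) (f : PartialEmb U V) : Prop where
  root : f r ≠ none
  inj : ∀ x y b, f x = some b → f y = some b → x = y
  parent : ∀ p c b, IsParent T r p c → f c = some b → ∃ a, f p = some a ∧ G.Adj a b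
  siblings : ∀ p c c', IsParent T r p c → IsParent T r p c' → f c ≠ none → f c' ≠ none

section Valid

variable {G : SimpleGraph V} {T : SimpleGraph U} {r : U} {f : PartialEmb U V}

theorem valid_root [DecidableEq U] (a : V) :
    Valid G T r (fun x => if x = r then some a else none) where
  root := by simp
  inj := by grind
  parent p c b hp hc := by
    have : c = r := by grind
    exact absurd (this ▸ hp) (not_isParent_root p)
  siblings p c c' hp _ hc := by
    have : c = r := by grind
    exact absurd (this ▸ hp) (not_isParent_root p)

theorem Valid.mem_success (hT : T.IsTree) (hf : Valid G T r f) (h : ∀ x, f x ≠ none) :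
    some f ∈ success G T := by
  have h' : ∀ x, ∃ a, f x = some a := fun x => Option.ne_none_iff_exists'.mp (h x)
  choose φ hφ using h'
  refine ⟨⟨⟨φ, fun {x y} hxy => ?_⟩, fun x y hxy => hf.inj x y (φ x) (hφ x) ?_⟩, ?_⟩
  · rcases isParent_or_isParent (r := r) hT hxy with h1 | h1
    · obtain ⟨a, ha, hab⟩ := hf.parent x y _ h1 (hφ y)
      rw [hφ x, Option.some_inj] at ha
      exact ha ▸ hab
    · obtain ⟨a, ha, hab⟩ := hf.parent y x _ h1 (hφ x)
      rw [hφ y, Option.some_inj] at ha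
      exact (ha ▸ hab).symm
  · exact (hφ y).trans (congrArg some (show φ x = φ y from hxy).symm)
  · exact congrArg some (funext hφ)

theorem mem_available [G.LocallyFinite] {a b : V} :
    b ∈ available G f a ↔ G.Adj a b ∧ ∀ x, f x ≠ some b := by
  simp [available]

theorem place_of_mem {C : Finset U} {A : Finset V} (g : C ↪ A) {c : U} (hc : c ∈ C) :
    place f C g c = some (g ⟨c, hc⟩ : V) := by
  simp [place, hc]

theorem place_of_notMem {C : Finset U} {A : Finset V} (g : C ↪ A) {c : U} (hc : c ∉ C) :
    place f C g c = f c := by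
  simp [place, hc]

variable [Fintype U]

theorem Valid.children_eq_none (hf : Valid G T r f) {x c : U} (hx : x ∈ pending T r f)
    (hc : IsParent T r x c) : f c = none := by
  obtain ⟨-, c', hc', hn⟩ := hx
  by_contra h
  exact hf.siblings x c c' hc (mem_children.mp hc') h hn

/-- The algorithm never gets stuck before completion. If nothing is pending, being embedded
propagates along every walk from the root: downwards because no children are missing, upwards
because the parent of an embedded vertex is embedded. -/
theorem Valid.pending_nonempty (hT : T.IsTree) (hf : Valid G T r f) (h : ¬ ∀ x, f x ≠ none) :
    (pending T r f).Nonempty := by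
  by_contra hp
  rw [Set.not_nonempty_iff_eq_empty] at hp
  refine h fun x => ?_
  obtain ⟨w⟩ := hT.connected.preconnected r x
  have key : ∀ (y z : U), T.Walk y z → f y ≠ none → f z ≠ none := by
    intro y z w
    induction w with
    | nil => exact id
    | @cons a b c hab _ ih =>
      intro ha
      refine ih fun hb => ?_
      rcases isParent_or_isParent (r := r) hT hab with h1 | h1
      · have : a ∈ pending T r f := ⟨ha, b, mem_children.mpr h1, hb⟩
        simp [hp] at this
      · obtain ⟨v, hv⟩ := Option.ne_none_iff_exists'.mp ha
        obtain ⟨u, hu, -⟩ := hf.parent b a v h1 hv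
        simp [hb] at hu
  exact key r x w hf.root

theorem Valid.place [G.LocallyFinite] (hT : T.IsTree) (hf : Valid G T r f) {x : U} {a : V}
    (hx : x ∈ pending T r f) (ha : f x = some a)
    (g : children T r x ↪ available G f a) :
    Valid G T r (place f (children T r x) g) where
  root := by
    rw [place_of_notMem g fun h => not_isParent_root x (mem_children.mp h)]
    exact hf.root
  inj y z b hy hz := by
    have hav : ∀ c : children T r x, ∀ t, f t ≠ some (g c : V) :=
      fun c => (mem_available.mp (g c).2).2
    by_cases h1 : y ∈ children T r x <;> by_cases h2 : z ∈ children T r x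
    · rw [place_of_mem g h1, Option.some_inj] at hy
      rw [place_of_mem g h2, Option.some_inj] at hz
      exact congrArg Subtype.val (g.injective (Subtype.ext (hy.trans hz.symm)))
    · rw [place_of_mem g h1, Option.some_inj] at hy
      rw [place_of_notMem g h2] at hz
      exact absurd (hy ▸ hz) (hav _ z)
    · rw [place_of_notMem g h1] at hy
      rw [place_of_mem g h2, Option.some_inj] at hz
      exact absurd (hz ▸ hy) (hav _ y)
    · rw [place_of_notMem g h1] at hy
      rw [place_of_notMem g h2] at hz
      exact hf.inj y z b hy hz
  parent p c b hp hc := by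
    by_cases h1 : c ∈ children T r x
    · obtain rfl : p = x := hp.unique hT (mem_children.mp h1)
      have hpp : p ∉ children T r p := fun h => (mem_children.mp h).1.ne rfl
      rw [place_of_mem g h1, Option.some_inj] at hc
      exact ⟨a, by rw [place_of_notMem g hpp, ha], hc ▸ (mem_available.mp (g _).2).1⟩
    · rw [place_of_notMem g h1] at hc
      obtain ⟨u, hu, hub⟩ := hf.parent p c b hp hc
      have hpp : p ∉ children T r x := fun h => by
        simp [hf.children_eq_none hx (mem_children.mp h)] at hu
      exact ⟨u, by rw [place_of_notMem g hpp, hu], hub⟩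
  siblings p c c' hp hp' hc := by
    by_cases hpx : p = x
    · subst hpx
      rw [place_of_mem g (mem_children.mpr hp')]
      simp
    · have h1 : c ∉ children T r x := fun h => hpx (hp.unique hT (mem_children.mp h))
      have h2 : c' ∉ children T r x := fun h => hpx (hp'.unique hT (mem_children.mp h))
      rw [place_of_notMem g h1] at hc
      rw [place_of_notMem g h2]
      exact hf.siblings p c c' hp hp' hc

end Valid

/-- The number of tree vertices that are not yet embedded. -/
noncomputable def numUnembedded [Fintype U] (f : PartialEmb U V) : ℕ := by
  classical exact (Finset.univ.filter fun x => f x = none).card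

section NumUnembedded

variable [Fintype U] {G : SimpleGraph V} {T : SimpleGraph U} {r : U} {f : PartialEmb U V}

theorem Valid.numUnembedded_lt (hf : Valid G T r f) : numUnembedded f < Fintype.card U := by
  classical
  refine Finset.card_lt_card (Finset.filter_ssubset.mpr ⟨r, Finset.mem_univ r, hf.root⟩)

theorem numUnembedded_eq_zero (h : numUnembedded f = 0) (x : U) : f x ≠ none := by
  classical
  intro hx
  rw [numUnembedded, Finset.card_eq_zero] at h
  exact Finset.notMem_empty x (h ▸ Finset.mem_filter.mpr ⟨Finset.mem_univ x, hx⟩)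

theorem numUnembedded_place {C : Finset U} {A : Finset V} (g : C ↪ A)
    (hC : ∀ c ∈ C, f c = none) :
    numUnembedded (place f C g) + C.card = numUnembedded f := by
  classical
  rw [numUnembedded, numUnembedded, ← Finset.card_union_of_disjoint]
  · congr 1
    ext c
    by_cases h : c ∈ C
    · simp [h, hC c h]
    · simp [h, place_of_notMem g h]
  · rw [Finset.disjoint_left]
    intro c hc hcC
    simp [place_of_mem g hcC] at hc

end NumUnembedded

/-! ### Random injections in a graph without 4-cycles. -/

theorem eq_of_adj_of_cycleGraph_four_free {G : SimpleGraph V}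
    (hG : (SimpleGraph.cycleGraph 4).Free G) {v w a b : V} (hvw : v ≠ w)
    (hva : G.Adj v a) (hwa : G.Adj w a) (hvb : G.Adj v b) (hwb : G.Adj w b) : a = b := by
  by_contra hab
  refine hG ⟨⟨⟨![v, a, w, b], fun {i j} hij => ?_⟩, fun i j hij => ?_⟩⟩
  · rw [SimpleGraph.cycleGraph_adj'] at hij
    fin_cases i <;> fin_cases j <;> revert hij <;>
      first
      | exact fun h => absurd h (by decide)
      | simp [hva, hva.symm, hwa, hwa.symm, hvb, hvb.symm, hwb, hwb.symm]
  · have h1 := hva.ne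
    have h2 := hwa.ne
    have h3 := hvb.ne
    have h4 := hwb.ne
    change ![v, a, w, b] i = ![v, a, w, b] j at hij
    fin_cases i <;> fin_cases j <;> revert hij <;>
      simp [hvw, hvw.symm, hab, Ne.symm hab, h1, h1.symm, h2, h2.symm, h3, h3.symm, h4, h4.symm]

/-- Under a uniform injection each single image is uniform: composing with a transposition of `β`
matches the injections with `g c = w` to those with `g c = u`. -/
theorem card_embedding_apply_eq_mul {α β : Type*} [Fintype α] [Fintype β] [DecidableEq α]
    [DecidableEq β] (c : α) (u : β) :
    (Finset.univ.filter fun g : α ↪ β => g c = u).card * Fintype.card β =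
      Fintype.card (α ↪ β) := by
  have hsymm : ∀ w : β, (Finset.univ.filter fun g : α ↪ β => g c = w).card =
      (Finset.univ.filter fun g : α ↪ β => g c = u).card := by
    intro w
    refine Finset.card_equiv (Equiv.embeddingCongr (Equiv.refl α) (Equiv.swap w u)) fun g => ?_
    have : (Equiv.embeddingCongr (Equiv.refl α) (Equiv.swap w u) g) c = Equiv.swap w u (g c) := rfl
    simp only [Finset.mem_filter, Finset.mem_univ, true_and, this]
    rw [← (Equiv.swap w u).injective.eq_iff, Equiv.swap_apply_left]
  have := Finset.card_eq_sum_card_fiberwise (f := fun g : α ↪ β => g c)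
    (s := Finset.univ) (t := Finset.univ) (fun _ _ => Finset.mem_coe.mpr (Finset.mem_univ _))
  rw [← Finset.card_univ (α := α ↪ β), this, Finset.sum_congr rfl fun w _ => hsymm w]
  simp [mul_comm]

-- The common neighbour `b` of `v` and `a` is unique, so a hit means that some `c` lands on `b`; a
-- union bound over `c` gives probability at most `|C| / |A|`.
open Classical in
theorem card_hit_mul_le {G : SimpleGraph V} (hG : (SimpleGraph.cycleGraph 4).Free G) {a v : V} (hva : v ≠ a)
    (C : Finset U) {A : Finset V} (hA : ∀ b ∈ A, G.Adj a b) :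
    (Finset.univ.filter fun g : C ↪ A => ∃ c, G.Adj v (g c)).card * A.card ≤
      C.card * Fintype.card (C ↪ A) := by
  by_cases h : ∃ b : A, G.Adj v b
  · obtain ⟨b, hb⟩ := h
    have hsub : (Finset.univ.filter fun g : C ↪ A => ∃ c, G.Adj v (g c)) ⊆
        Finset.univ.biUnion fun c : C => Finset.univ.filter fun g : C ↪ A => g c = b := by
      intro g hg
      obtain ⟨c, hc⟩ := (Finset.mem_filter.mp hg).2
      simp only [Finset.mem_biUnion, Finset.mem_univ, true_and, Finset.mem_filter]
      exact ⟨c, Subtype.ext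
        (eq_of_adj_of_cycleGraph_four_free hG hva hc (hA _ (g c).2) hb (hA _ b.2))⟩
    calc _ ≤ (∑ c : C, (Finset.univ.filter fun g : C ↪ A => g c = b).card) * A.card :=
          Nat.mul_le_mul_right _ ((Finset.card_le_card hsub).trans Finset.card_biUnion_le)
      _ = ∑ c : C, Fintype.card (C ↪ A) := by
          rw [Finset.sum_mul]
          refine Finset.sum_congr rfl fun c _ => ?_
          rw [← card_embedding_apply_eq_mul c b, Fintype.card_coe]
      _ = C.card * Fintype.card (C ↪ A) := by simp
  · rw [Finset.filter_eq_empty_iff.mpr]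
    · simp
    · rintro g - ⟨c, hc⟩
      exact h ⟨g c, hc⟩

/-! ### Loads and the crowd. -/

open Classical in
/-- The vertices of the host graph that are occupied by tree vertices. -/
noncomputable def occupied [Fintype U] (f : PartialEmb U V) : Finset V :=
  (Finset.univ.image f).eraseNone

open Classical in
/-- The number of occupied neighbours of `v`. -/
noncomputable def load [Fintype U] (G : SimpleGraph V) (f : PartialEmb U V) (v : V) : ℕ :=
  ((occupied f).filter fun b => G.Adj v b).card

open Classical in
/-- The vertices of the host graph with at least two occupied neighbours. -/
noncomputable def crowd [Fintype U] (G : SimpleGraph V) [G.LocallyFinite] (f : PartialEmb U V) :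
    Finset V :=
  ((occupied f).biUnion fun b => G.neighborFinset b).filter fun v => 2 ≤ load G f v

open Classical in
/-- The vertices with at least two occupied neighbours at which no children have been placed
yet. -/
noncomputable def risky [Fintype U] (G : SimpleGraph V) [G.LocallyFinite] (T : SimpleGraph U)
    (r : U) (f : PartialEmb U V) : Finset V :=
  (crowd G f).filter fun v => ∀ x, f x = some v → ∀ c, IsParent T r x c → f c = none

section Load

variable [Fintype U] {G : SimpleGraph V} {T : SimpleGraph U} {r : U} {f : PartialEmb U V}

theorem mem_occupied {b : V} : b ∈ occupied f ↔ ∃ x, f x = some b := by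
  simp [occupied]

theorem card_occupied_le : (occupied f).card ≤ Fintype.card U := by
  classical
  exact (Finset.card_eraseNone_le _).trans Finset.card_image_le

theorem card_available_add_load [G.LocallyFinite] (a : V) :
    (available G f a).card + load G f a = G.degree a := by
  classical
  rw [← SimpleGraph.card_neighborFinset_eq_degree,
    ← Finset.card_filter_add_card_filter_not (s := G.neighborFinset a) fun b => ∀ x, f x ≠ some b]
  congr 1
  · exact congrArg Finset.card (by ext b; simp [available])
  · refine congrArg Finset.card ?_
    ext b
    simp [mem_occupied, and_comm]

theorem mem_crowd [G.LocallyFinite] {v : V} : v ∈ crowd G f ↔ 2 ≤ load G f v := by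
  classical
  simp only [crowd, Finset.mem_filter, Finset.mem_biUnion, SimpleGraph.mem_neighborFinset,
    and_iff_right_iff_imp]
  intro h
  obtain ⟨b, hb⟩ := Finset.card_pos.mp (lt_of_lt_of_le two_pos h)
  rw [Finset.mem_filter] at hb
  exact ⟨b, hb.1, hb.2.symm⟩

theorem mem_risky [G.LocallyFinite] {v : V} : v ∈ risky G T r f ↔
    2 ≤ load G f v ∧ ∀ x, f x = some v → ∀ c, IsParent T r x c → f c = none := by
  simp [risky, mem_crowd]

/-- Two crowd vertices sharing the same ordered pair of distinct occupied neighbours would span a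
4-cycle, so choosing a pair for each is injective. -/
theorem card_crowd_le [G.LocallyFinite] (hG : (SimpleGraph.cycleGraph 4).Free G) :
    (crowd G f).card ≤ Fintype.card U * Fintype.card U - Fintype.card U := by
  classical
  have hpair : ∀ v : crowd G f, ∃ p ∈ (occupied f).offDiag, G.Adj v p.1 ∧ G.Adj v p.2 := by
    rintro ⟨v, hv⟩
    obtain ⟨a, ha, b, hb, hab⟩ := Finset.one_lt_card.mp (mem_crowd.mp hv)
    rw [Finset.mem_filter] at ha hb
    exact ⟨(a, b), Finset.mem_offDiag.mpr ⟨ha.1, hb.1, hab⟩, ha.2, hb.2⟩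
  choose p hp hp1 hp2 using hpair
  have hcard : (crowd G f).card ≤ (occupied f).offDiag.card := by
    rw [← Finset.card_attach]
    refine Finset.card_le_card_of_injOn p (fun v _ => hp v) fun v _ w _ hvw => ?_
    by_contra hne
    have hne' : (v : V) ≠ w := fun h => hne (Subtype.ext h)
    refine (Finset.mem_offDiag.mp (hp v)).2.2
      (eq_of_adj_of_cycleGraph_four_free hG hne' (hp1 v) ?_ (hp2 v) ?_)
    · exact hvw ▸ hp1 w
    · exact hvw ▸ hp2 w
  rw [Finset.offDiag_card, ← Nat.mul_sub_one] at hcard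
  rw [← Nat.mul_sub_one]
  exact hcard.trans (Nat.mul_le_mul card_occupied_le (Nat.sub_le_sub_right card_occupied_le 1))

section Place

variable {C : Finset U} {A : Finset V} (g : C ↪ A)

theorem occupied_place_subset [DecidableEq V] :
    occupied (place f C g) ⊆
      occupied f ∪ Finset.univ.map (g.trans (Function.Embedding.subtype _)) := by
  intro b hb
  obtain ⟨x, hx⟩ := mem_occupied.mp hb
  rw [Finset.mem_union]
  by_cases h : x ∈ C
  · rw [place_of_mem g h, Option.some_inj] at hx
    exact Or.inr (Finset.mem_map.mpr ⟨⟨x, h⟩, Finset.mem_univ _, hx⟩)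
  · rw [place_of_notMem g h] at hx
    exact Or.inl (mem_occupied.mpr ⟨x, hx⟩)

theorem load_le_load_place (hC : ∀ c ∈ C, f c = none) (v : V) :
    load G f v ≤ load G (place f C g) v := by
  classical
  refine Finset.card_le_card (Finset.filter_subset_filter _ fun b hb => ?_)
  obtain ⟨x, hx⟩ := mem_occupied.mp hb
  refine mem_occupied.mpr ⟨x, ?_⟩
  rw [place_of_notMem g fun h => by simp [hC x h] at hx, hx]

open Classical in
theorem load_place_le (hG : (SimpleGraph.cycleGraph 4).Free G) {a v : V} (hva : v ≠ a)
    (hA : ∀ b ∈ A, G.Adj a b) :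
    load G (place f C g) v ≤ load G f v + if ∃ c, G.Adj v (g c) then 1 else 0 := by
  have h1 : load G (place f C g) v ≤ load G f v +
      ((Finset.univ.map (g.trans (Function.Embedding.subtype _))).filter
        fun b => G.Adj v b).card := by
    refine le_trans (Finset.card_le_card
      (Finset.filter_subset_filter _ (occupied_place_subset g))) ?_
    rw [Finset.filter_union]
    exact Finset.card_union_le _ _
  refine h1.trans (Nat.add_le_add_left ?_ _)
  split_ifs with h
  · rw [Finset.card_le_one]
    simp only [Finset.mem_filter, Finset.mem_map, Finset.mem_univ, true_and]
    rintro _ ⟨⟨c, rfl⟩, hc⟩ _ ⟨⟨c', rfl⟩, hc'⟩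
    exact eq_of_adj_of_cycleGraph_four_free hG hva hc (hA _ (g c).2) hc' (hA _ (g c').2)
  · rw [Nat.le_zero, Finset.card_eq_zero, Finset.filter_eq_empty_iff]
    simp only [Finset.mem_map, Finset.mem_univ, true_and]
    rintro _ ⟨c, rfl⟩ hc
    exact h ⟨c, hc⟩

/-- The exponential moment estimate, summed over all injections instead of averaged. It comes from
the hit probability and `1 + t ≤ exp t`. -/
theorem sum_exp_load_place_le (hG : (SimpleGraph.cycleGraph 4).Free G) {a v : V} (hva : v ≠ a)
    (hA : ∀ b ∈ A, G.Adj a b) {l D : ℝ} (hl : 0 ≤ l) (hD : 0 < D)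
    (hDA : D ≤ A.card) :
    ∑ g : C ↪ A, Real.exp (l * load G (place f C g) v) ≤
      Fintype.card (C ↪ A) * (Real.exp (l * load G f v) *
        Real.exp ((Real.exp l - 1) / D * C.card)) := by
  classical
  have hl1 : 0 ≤ Real.exp l - 1 := by linarith [Real.add_one_le_exp l]
  have hApos : (0 : ℝ) < A.card := hD.trans_le hDA
  have hterm : ∀ g : C ↪ A, Real.exp (l * load G (place f C g) v) ≤
      Real.exp (l * load G f v) *
        (1 + (Real.exp l - 1) * if ∃ c, G.Adj v (g c) then 1 else 0) := by
    intro g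
    have h := load_place_le (f := f) g hG hva hA
    split_ifs at h ⊢
    · rw [mul_one, add_sub_cancel, ← Real.exp_add, Real.exp_le_exp]
      have : (load G (place f C g) v : ℝ) ≤ load G f v + 1 := by exact_mod_cast h
      nlinarith
    · rw [mul_zero, add_zero, mul_one, Real.exp_le_exp]
      have : (load G (place f C g) v : ℝ) ≤ load G f v := by exact_mod_cast h
      nlinarith
  have hhit : ((Finset.univ.filter fun g : C ↪ A => ∃ c, G.Adj v (g c)).card : ℝ) ≤
      Fintype.card (C ↪ A) * (C.card / D) := by
    have h : ((Finset.univ.filter fun g : C ↪ A => ∃ c, G.Adj v (g c)).card : ℝ) * A.card ≤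
        C.card * Fintype.card (C ↪ A) := by exact_mod_cast card_hit_mul_le hG hva C hA
    rw [← mul_div_assoc, le_div_iff₀ hD]
    calc _ ≤ ((Finset.univ.filter fun g : C ↪ A => ∃ c, G.Adj v (g c)).card : ℝ) * A.card := by
          gcongr
      _ ≤ _ := h.trans_eq (mul_comm _ _)
  calc _ ≤ ∑ g : C ↪ A, Real.exp (l * load G f v) *
        (1 + (Real.exp l - 1) * if ∃ c, G.Adj v (g c) then 1 else 0) :=
        Finset.sum_le_sum fun g _ => hterm g
    _ = Real.exp (l * load G f v) * (Fintype.card (C ↪ A) + (Real.exp l - 1) *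
          (Finset.univ.filter fun g : C ↪ A => ∃ c, G.Adj v (g c)).card) := by
        rw [← Finset.mul_sum, Finset.sum_add_distrib, ← Finset.mul_sum, Finset.sum_boole]
        simp
    _ ≤ Real.exp (l * load G f v) * (Fintype.card (C ↪ A) + (Real.exp l - 1) *
          (Fintype.card (C ↪ A) * (C.card / D))) := by gcongr
    _ = Fintype.card (C ↪ A) * (Real.exp (l * load G f v) *
          ((Real.exp l - 1) / D * C.card + 1)) := by ring
    _ ≤ _ := by
        gcongr
        exact Real.add_one_le_exp _

end Place

end Load

/-! ### Success probability and the potential. -/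

section Run

variable [Fintype U] {G : SimpleGraph V} [G.LocallyFinite]
  {T : SimpleGraph U} {r : U} {f : PartialEmb U V}

/-- The probability that the algorithm succeeds within `n` further steps. -/
noncomputable def successProb (G : SimpleGraph V) [G.LocallyFinite] (T : SimpleGraph U) (r : U)
    (σ : SelectionRule T r V) (n : ℕ) (past : List (PartialEmb U V)) (f : PartialEmb U V) : ℝ :=
  ((run G T r σ n past f).toOuterMeasure (success G T)).toReal

theorem successProb_nonneg (σ : SelectionRule T r V) (n : ℕ) (past : List (PartialEmb U V)) :
    0 ≤ successProb G T r σ n past f :=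
  ENNReal.toReal_nonneg

theorem successProb_of_forall_ne_none (hT : T.IsTree) (hf : Valid G T r f)
    (h : ∀ x, f x ≠ none) (σ : SelectionRule T r V) (n : ℕ) (past : List (PartialEmb U V)) :
    successProb G T r σ n past f = 1 := by
  have hrun : run G T r σ n past f = PMF.pure (some f) := by
    cases n with
    | zero => rfl
    | succ n => rw [run, if_pos h]
  rw [successProb, hrun, PMF.toOuterMeasure_pure_apply, if_pos (hf.mem_success hT h)]
  rfl

/-- The law of total probability for one step, with the uniform weight cleared from the denominator.
-/
theorem successProb_succ (h : ¬ ∀ x, f x ≠ none) (σ : SelectionRule T r V) (n : ℕ)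
    (past : List (PartialEmb U V)) {a : V} (ha : f (σ.next past f) = some a)
    (hC : (children T r (σ.next past f)).card ≤ (available G f a).card) :
    Fintype.card (children T r (σ.next past f) ↪ available G f a) *
        successProb G T r σ (n + 1) past f =
      ∑ g : children T r (σ.next past f) ↪ available G f a,
        successProb G T r σ n (f :: past) (place f (children T r (σ.next past f)) g) := by
  have hne : Nonempty (children T r (σ.next past f) ↪ available G f a) :=
    Function.Embedding.nonempty_of_card_le (by simpa using hC)
  have hstep : step G T r f (σ.next past f) =
      (uniformInjection (children T r (σ.next past f)) (available G f a) hC).map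
        fun g => some (place f (children T r (σ.next past f)) g) := by
    rw [step]
    split
    · simp_all
    · rename_i b hb
      obtain rfl : b = a := by simpa [ha] using hb.symm
      rw [dif_pos hC]
  have hcard : (Fintype.card (children T r (σ.next past f) ↪ available G f a) : ℝ) ≠ 0 :=
    Nat.cast_ne_zero.mpr Fintype.card_ne_zero
  rw [successProb, run, if_neg h, hstep, PMF.bind_map, PMF.toOuterMeasure_bind_apply,
    tsum_fintype, ENNReal.toReal_sum, Finset.mul_sum]
  · refine Finset.sum_congr rfl fun g _ => ?_
    rw [ENNReal.toReal_mul, uniformInjection, PMF.uniformOfFintype_apply, ENNReal.toReal_inv,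
      ENNReal.toReal_natCast, ← mul_assoc]
    rw [show (Fintype.card (children T r (σ.next past f) ↪ available G f a) : ℝ) *
      _ = 1 by convert mul_inv_cancel₀ hcard, one_mul]
    rfl
  · intro g _
    refine ENNReal.mul_ne_top (PMF.apply_ne_top _ _) ?_
    refine ne_top_of_le_ne_top ENNReal.one_ne_top ?_
    exact (MeasureTheory.measure_mono (Set.subset_univ _)).trans
      ((PMF.toOuterMeasure_apply_eq_one_iff _ _).mpr (Set.subset_univ _)).le

/-- An upper estimate for the probability that the algorithm fails when continued from `f`: each
risky vertex contributes an exponential of its load, and each vertex that may still join the crowd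
contributes the cost of joining it. -/
noncomputable def potential (G : SimpleGraph V) [G.LocallyFinite] (T : SimpleGraph U) (r : U)
    (l K θ : ℝ) (f : PartialEmb U V) : ℝ :=
  ∑ v ∈ risky G T r f, Real.exp (l * (load G f v - K) + θ * numUnembedded f) +
    Real.exp (l * (2 - K) + θ * (Fintype.card U - 1)) *
      (Fintype.card U * Fintype.card U - Fintype.card U - (crowd G f).card)

variable {l K θ : ℝ}

theorem sum_risky_le_potential (hG : (SimpleGraph.cycleGraph 4).Free G) :
    ∑ v ∈ risky G T r f, Real.exp (l * (load G f v - K) + θ * numUnembedded f) ≤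
      potential G T r l K θ f := by
  have h := card_crowd_le (f := f) hG
  have h' : ((crowd G f).card : ℝ) ≤ Fintype.card U * Fintype.card U - Fintype.card U := by
    rw [← Nat.cast_mul, ← Nat.cast_sub (Nat.le_mul_self _)]
    exact_mod_cast h
  exact le_add_of_nonneg_right (mul_nonneg (Real.exp_nonneg _) (by linarith))

theorem potential_nonneg (hG : (SimpleGraph.cycleGraph 4).Free G) :
    0 ≤ potential G T r l K θ f :=
  (Finset.sum_nonneg fun _ _ => Real.exp_nonneg _).trans (sum_risky_le_potential hG)

theorem one_le_potential (hG : (SimpleGraph.cycleGraph 4).Free G) (hl : 0 ≤ l) (hθ : 0 ≤ θ)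
    (hK : 2 ≤ K) (hf : Valid G T r f) {x : U} {a : V} (hx : x ∈ pending T r f)
    (ha : f x = some a) (h : K ≤ load G f a) : 1 ≤ potential G T r l K θ f := by
  have hmem : a ∈ risky G T r f := by
    refine mem_risky.mpr ⟨by exact_mod_cast hK.trans h, fun y hy c hc => ?_⟩
    obtain rfl := hf.inj x y a ha hy
    exact hf.children_eq_none hx hc
  refine le_trans ?_ ((Finset.single_le_sum (fun v _ => Real.exp_nonneg
    (l * (load G f v - K) + θ * numUnembedded f)) hmem).trans (sum_risky_le_potential hG))
  exact Real.one_le_exp (add_nonneg (mul_nonneg hl (by linarith))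
    (mul_nonneg hθ (Nat.cast_nonneg _)))

/-- A deterministic bound for each outcome: newcomers to the crowd are paid for by the drop in the
second term, leaving only the old risky vertices other than `a` to be averaged. -/
theorem potential_place_le [DecidableEq V] (hG : (SimpleGraph.cycleGraph 4).Free G)
    (hT : T.IsTree) (hl : 0 ≤ l) (hθ : 0 ≤ θ) (hf : Valid G T r f) {x : U} {a : V}
    (hx : x ∈ pending T r f) (ha : f x = some a)
    (g : children T r x ↪ available G f a) :
    potential G T r l K θ (place f (children T r x) g) ≤
      ∑ v ∈ (risky G T r f).erase a,
        Real.exp (l * (load G (place f (children T r x) g) v - K) +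
          θ * numUnembedded (place f (children T r x) g)) +
      Real.exp (l * (2 - K) + θ * (Fintype.card U - 1)) *
        (Fintype.card U * Fintype.card U - Fintype.card U - (crowd G f).card) := by
  set f' := place f (children T r x) g with hf'
  have hnone : ∀ c ∈ children T r x, f c = none :=
    fun c hc => hf.children_eq_none hx (mem_children.mp hc)
  have hf'v : Valid G T r f' := hf.place hT hx ha g
  have hkeep : ∀ y b, f y = some b → f' y = some b := fun y b hy => by
    rw [hf', place_of_notMem g fun h => by simp [hnone y h] at hy, hy]
  -- The load of `a` itself may jump by many, but its children are now placed, so it is no longer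
  -- risky.
  have hne : ∀ v ∈ risky G T r f', v ≠ a := by
    rintro v hv rfl
    obtain ⟨-, c, hc, -⟩ := hx
    have := (mem_risky.mp hv).2 x (hkeep x v ha) c (mem_children.mp hc)
    rw [hf', place_of_mem g hc] at this
    exact Option.some_ne_none _ this
  have hcrowd : crowd G f ⊆ crowd G f' := fun v hv =>
    mem_crowd.mpr ((mem_crowd.mp hv).trans (load_le_load_place g hnone v))
  have hold : (risky G T r f').filter (· ∈ crowd G f) ⊆ (risky G T r f).erase a := by
    intro v hv
    obtain ⟨hv, hvc⟩ := Finset.mem_filter.mp hv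
    refine Finset.mem_erase.mpr ⟨hne v hv, mem_risky.mpr ⟨mem_crowd.mp hvc, fun y hy c hc => ?_⟩⟩
    have h := (mem_risky.mp hv).2 y (hkeep y v hy) c hc
    by_contra h'
    obtain ⟨b, hb⟩ := Option.ne_none_iff_exists'.mp h'
    simp [hkeep c b hb] at h
  have hnew : (risky G T r f').filter (· ∉ crowd G f) ⊆ crowd G f' \ crowd G f := by
    intro v hv
    obtain ⟨hv, hvc⟩ := Finset.mem_filter.mp hv
    exact Finset.mem_sdiff.mpr ⟨mem_crowd.mpr (mem_risky.mp hv).1, hvc⟩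
  have hm : (numUnembedded f' : ℝ) ≤ Fintype.card U - 1 := by
    have := hf'v.numUnembedded_lt
    rw [le_sub_iff_add_le]
    exact_mod_cast this
  have hterm : ∀ v ∈ (risky G T r f').filter (· ∉ crowd G f),
      Real.exp (l * (load G f' v - K) + θ * numUnembedded f') ≤
        Real.exp (l * (2 - K) + θ * (Fintype.card U - 1)) := by
    intro v hv
    obtain ⟨hv, hvc⟩ := Finset.mem_filter.mp hv
    have h1 : load G f' v ≤ load G f v + _ :=
      load_place_le g hG (hne v hv) fun b hb => (mem_available.mp hb).1
    -- A newcomer had load at most 1 and gained at most 1, so it enters at the prepaid price.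
    have h2 : load G f' v ≤ 2 := by
      rw [mem_crowd] at hvc
      split_ifs at h1 <;> omega
    have h3 : (load G f' v : ℝ) ≤ 2 := by exact_mod_cast h2
    gcongr
  have hsum : ∑ v ∈ (risky G T r f').filter (· ∉ crowd G f),
      Real.exp (l * (load G f' v - K) + θ * numUnembedded f') ≤
        Real.exp (l * (2 - K) + θ * (Fintype.card U - 1)) *
          ((crowd G f').card - (crowd G f).card) := by
    refine (Finset.sum_le_card_nsmul _ _ _ hterm).trans ?_
    have h : (((risky G T r f').filter (· ∉ crowd G f)).card : ℝ) ≤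
        (crowd G f').card - (crowd G f).card := by
      rw [← Finset.cast_card_sdiff hcrowd]
      exact_mod_cast Finset.card_le_card hnew
    rw [nsmul_eq_mul, mul_comm]
    gcongr
  rw [potential, ← Finset.sum_filter_add_sum_filter_not _ (· ∈ crowd G f)]
  have hsum' := Finset.sum_le_sum_of_subset_of_nonneg hold fun v _ _ =>
    Real.exp_nonneg (l * (load G f' v - K) + θ * numUnembedded f')
  linarith

theorem sum_potential_place_le (hG : (SimpleGraph.cycleGraph 4).Free G) (hT : T.IsTree)
    (hl : 0 ≤ l) {D : ℝ} (hD : 0 < D) (hf : Valid G T r f) {x : U} {a : V}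
    (hx : x ∈ pending T r f) (ha : f x = some a) (hDa : D ≤ (available G f a).card) :
    ∑ g : children T r x ↪ available G f a,
        potential G T r l K ((Real.exp l - 1) / D) (place f (children T r x) g) ≤
      Fintype.card (children T r x ↪ available G f a) *
        potential G T r l K ((Real.exp l - 1) / D) f := by
  classical
  have hθ : 0 ≤ (Real.exp l - 1) / D :=
    div_nonneg (by linarith [Real.add_one_le_exp l]) hD.le
  set θ := (Real.exp l - 1) / D with hθ_def
  have hnone : ∀ c ∈ children T r x, f c = none :=
    fun c hc => hf.children_eq_none hx (mem_children.mp hc)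
  refine (Finset.sum_le_sum fun g _ => potential_place_le hG hT hl hθ hf hx ha g).trans ?_
  rw [Finset.sum_add_distrib, Finset.sum_comm, potential, mul_add, Finset.sum_const,
    Finset.card_univ, nsmul_eq_mul, Finset.mul_sum]
  gcongr ?_ + _
  refine le_trans (Finset.sum_le_sum fun v hv => ?_)
    (Finset.sum_le_sum_of_subset_of_nonneg (Finset.erase_subset a _) fun v _ _ => by positivity)
  have hm : ∀ g : children T r x ↪ available G f a,
      (numUnembedded (place f (children T r x) g) : ℝ) =
        numUnembedded f - (children T r x).card := fun g => by
    rw [eq_sub_iff_add_eq]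
    exact_mod_cast numUnembedded_place g hnone
  have hsum := sum_exp_load_place_le (f := f) (C := children T r x) hG (Finset.ne_of_mem_erase hv)
    (fun b hb => (mem_available.mp hb).1) hl hD hDa
  rw [← hθ_def] at hsum
  calc _ = (∑ g : children T r x ↪ available G f a,
          Real.exp (l * load G (place f (children T r x) g) v)) *
            Real.exp (-l * K + θ * (numUnembedded f - (children T r x).card)) := by
        rw [Finset.sum_mul]
        refine Finset.sum_congr rfl fun g _ => ?_
        rw [← Real.exp_add, hm g]
        ring_nf
    _ ≤ _ := mul_le_mul_of_nonneg_right hsum (Real.exp_nonneg _)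
    _ = _ := by
        -- The growth factor `exp (θ * |C|)` cancels against the decrease of `numUnembedded` by
        -- `|C|`.
        rw [mul_assoc, ← Real.exp_add, ← Real.exp_add]
        ring_nf

/-- Induction on the steps left. If the selected vertex sits at load at least `K`, the potential is
already at least 1 and the bound is trivial; otherwise the step succeeds and the supermartingale
inequality applies. -/
theorem one_sub_successProb_le_potential (hG : (SimpleGraph.cycleGraph 4).Free G)
    (hT : T.IsTree) {d : ℕ} (hd : ∀ a, d ≤ G.degree a) (hl : 0 ≤ l) (hK : 2 ≤ K) {D : ℝ}
    (hdK : D + K = d) (hTD : ∀ x, ((children T r x).card : ℝ) ≤ D) (σ : SelectionRule T r V)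
    (n : ℕ) :
    ∀ (past : List (PartialEmb U V)) (f : PartialEmb U V), Valid G T r f →
      numUnembedded f ≤ n →
      1 - successProb G T r σ n past f ≤ potential G T r l K ((Real.exp l - 1) / D) f := by
  have hD : 0 ≤ D := (Nat.cast_nonneg _).trans (hTD r)
  have hθ : 0 ≤ (Real.exp l - 1) / D := div_nonneg (by linarith [Real.add_one_le_exp l]) hD
  induction n with
  | zero =>
    intro past f hf hn
    rw [successProb_of_forall_ne_none hT hf (numUnembedded_eq_zero (Nat.le_zero.mp hn)), sub_self]
    exact potential_nonneg hG
  | succ n ih =>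
    intro past f hf hn
    by_cases h : ∀ x, f x ≠ none
    · rw [successProb_of_forall_ne_none hT hf h, sub_self]
      exact potential_nonneg hG
    have hx := σ.next_mem past f (hf.pending_nonempty hT h)
    obtain ⟨a, ha⟩ := Option.ne_none_iff_exists'.mp hx.1
    rcases le_or_gt K (load G f a) with hload | hload
    · exact (sub_le_self _ (successProb_nonneg σ _ past)).trans
        (one_le_potential hG hl hθ hK hf hx ha hload)
    have hDa : D ≤ (available G f a).card := by
      have h1 : ((available G f a).card : ℝ) + load G f a = G.degree a := by
        exact_mod_cast card_available_add_load a
      have h2 : (d : ℝ) ≤ G.degree a := by exact_mod_cast hd a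
      linarith
    have hC : (children T r (σ.next past f)).card ≤ (available G f a).card := by
      exact_mod_cast (hTD _).trans hDa
    have hCpos : 0 < (children T r (σ.next past f)).card := by
      obtain ⟨-, c, hc, -⟩ := hx
      exact Finset.card_pos.mpr ⟨c, hc⟩
    have hDpos : 0 < D := lt_of_lt_of_le (by exact_mod_cast hCpos) (hTD (σ.next past f))
    have hne : Nonempty (children T r (σ.next past f) ↪ available G f a) :=
      Function.Embedding.nonempty_of_card_le (by simpa using hC)
    have hcard : (0 : ℝ) <
        Fintype.card (children T r (σ.next past f) ↪ available G f a) :=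
      Nat.cast_pos.mpr Fintype.card_pos
    refine le_of_mul_le_mul_left ?_ hcard
    refine le_trans ?_ (sum_potential_place_le hG hT hl hDpos hf hx ha hDa)
    rw [mul_sub, successProb_succ h σ n past ha hC, mul_one]
    calc _ = ∑ g : children T r (σ.next past f) ↪ available G f a,
          (1 - successProb G T r σ n (f :: past)
            (place f (children T r (σ.next past f)) g)) := by
          simp [Finset.sum_sub_distrib]
      _ ≤ _ := Finset.sum_le_sum fun g _ => by
          refine ih _ _ (hf.place hT hx ha g) ?_
          have := numUnembedded_place (f := f) g fun c hc => hf.children_eq_none hx (mem_children.mp hc)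
          omega

/-- One occupied vertex gives loads of at most 1, so nothing is risky and only the prepaid term
remains. -/
theorem potential_root [DecidableEq U] (a : V) :
    potential G T r l K θ (fun x => if x = r then some a else none) =
      Real.exp (l * (2 - K) + θ * (Fintype.card U - 1)) *
        (Fintype.card U * Fintype.card U - Fintype.card U) := by
  classical
  have hload : ∀ v, load G (fun x => if x = r then some a else none) v ≤ 1 := by
    intro v
    refine (Finset.card_le_card (Finset.filter_subset _ _)).trans
      (Finset.card_le_one.mpr fun b hb c hc => ?_)
    obtain ⟨y, hy⟩ := mem_occupied.mp hb
    obtain ⟨z, hz⟩ := mem_occupied.mp hc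
    grind
  have h1 : crowd G (fun x => if x = r then some a else none) = ∅ :=
    Finset.eq_empty_of_forall_notMem fun v hv => by
      have := mem_crowd.mp hv
      have := hload v
      omega
  have h2 : risky G T r (fun x => if x = r then some a else none) = ∅ := by
    rw [risky, h1, Finset.filter_empty]
  simp [potential, h1, h2]

/-! ### Numerical estimate and conclusion. -/

theorem exists_forall_failure_bound_le {ε η : ℝ} (hε : 0 ≤ ε) (hε' : ε ≤ 1 / 8) (hη : 0 < η) :
    ∃ d₀ : ℕ, ∀ d : ℕ, d₀ ≤ d → ∀ m : ℝ, 0 ≤ m → m ≤ ε * (d : ℝ) ^ 2 →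
      Real.exp (1 / 2 * (2 - (2 * ε * d + 2)) +
        (Real.exp (1 / 2) - 1) / (d - 2 * ε * d - 2) * m) * ((m + 1) * m) ≤ η := by
  rcases hε.eq_or_lt with rfl | hpos
  · refine ⟨0, fun d _ m hm hm' => ?_⟩
    obtain rfl : m = 0 := le_antisymm (by simpa using hm') hm
    simpa using hη.le
  -- This is `2 d⁴ exp (-εd/20)`, written through `t⁴ exp (-t)` with `t = εd/20`.
  have hlim : Filter.Tendsto (fun d : ℕ => 2 / (ε / 20) ^ 4 * ((ε / 20 * (d : ℝ)) ^ 4 *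
      Real.exp (-(ε / 20 * (d : ℝ))))) Filter.atTop (nhds (2 / (ε / 20) ^ 4 * 0)) :=
    ((Real.tendsto_pow_mul_exp_neg_atTop_nhds_zero 4).comp
      (tendsto_natCast_atTop_atTop.const_mul_atTop (by positivity))).const_mul _
  rw [mul_zero] at hlim
  obtain ⟨d₁, hd₁⟩ := Filter.eventually_atTop.mp (hlim.eventually_le_const hη)
  -- For `d ≥ 40` and `ε ≤ 1/8` the denominator is at least `0.75 d - 2 ≥ 0.7 d`. As `0.65 / 0.7 <
  -- 0.95`, the exponent is at most `-εd + 0.95 εd = -εd/20`.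
  refine ⟨max d₁ 40, fun d hd m hm hm' => le_trans ?_ (hd₁ d (le_of_max_le_left hd))⟩
  have hd40 : (40 : ℝ) ≤ d := by exact_mod_cast le_of_max_le_right hd
  have hεd : 0 < ε * d := by positivity
  have hexp : Real.exp (1 / 2) ≤ 1.65 := by
    have h1 : Real.exp (1 / 2) * Real.exp (1 / 2) = Real.exp 1 := by
      rw [← Real.exp_add]; norm_num
    have := Real.exp_one_lt_d9
    nlinarith [Real.exp_pos (1 / 2)]
  have hden : 0.7 * (d : ℝ) ≤ d - 2 * ε * d - 2 := by nlinarith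
  have hθ : (Real.exp (1 / 2) - 1) / (d - 2 * ε * d - 2) * m ≤ 0.95 * (ε * d) := by
    rw [div_mul_eq_mul_div, div_le_iff₀ (by linarith)]
    calc (Real.exp (1 / 2) - 1) * m ≤ 0.65 * (ε * (d : ℝ) ^ 2) := by
          have : Real.exp (1 / 2) - 1 ≤ 0.65 := by linarith
          gcongr
      _ ≤ 0.95 * (ε * d) * (0.7 * d) := by nlinarith
      _ ≤ _ := by gcongr
  have hm1 : m ≤ (d : ℝ) ^ 2 := by nlinarith [sq_nonneg (d : ℝ)]
  calc _ ≤ Real.exp (-(ε / 20 * d)) * (((d : ℝ) ^ 2 + (d : ℝ) ^ 2) * (d : ℝ) ^ 2) := by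
        have : (1 : ℝ) ≤ (d : ℝ) ^ 2 := by nlinarith
        gcongr
        nlinarith
    _ = _ := by field_simp; ring

end Run

end TreeEmbedding

theorem theorem2p1 (ε : ℝ) (hε : ε ≤ 1 / 8) :
    ∀ η : ℝ, 0 < η → ∃ d₀ : ℕ, ∀ d : ℕ, d₀ ≤ d →
      ∀ (V : Type*) (G : SimpleGraph V) [G.LocallyFinite],
        (SimpleGraph.cycleGraph 4).Free G →
        (∀ a : V, d ≤ G.degree a) →
      ∀ (U : Type*) [Fintype U] (T : SimpleGraph U) [DecidableRel T.Adj],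
        T.IsTree →
        (T.edgeFinset.card : ℝ) ≤ ε * (d : ℝ) ^ 2 →
        (T.maxDegree : ℝ) ≤ d - 2 * ε * d - 2 →
      ∀ (r : U) (a : V) (σ : TreeEmbedding.SelectionRule T r V),
        1 - η ≤ ((TreeEmbedding.algorithm G T r a σ).toOuterMeasure (TreeEmbedding.success G T)).toReal := by
  intro η hη
  rcases lt_or_ge ε 0 with hneg | hpos
  · refine ⟨1, fun d hd V G _ _ _ U _ T _ _ hcard => ?_⟩
    have hd' : (1 : ℝ) ≤ d := by exact_mod_cast hd
    have h0 : (0 : ℝ) ≤ T.edgeFinset.card := Nat.cast_nonneg _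
    nlinarith [mul_pos (neg_pos.mpr hneg) (pow_pos (by linarith : (0 : ℝ) < d) 2)]
  obtain ⟨d₀, hd₀⟩ := TreeEmbedding.exists_forall_failure_bound_le hpos hε hη
  refine ⟨d₀, fun d hd V G _ hG hdeg U _ T _ hT hcard hmax r a σ => ?_⟩
  classical
  have hm : (T.edgeFinset.card : ℝ) + 1 = Fintype.card U := by
    exact_mod_cast hT.card_edgeFinset
  have hvalid : TreeEmbedding.Valid G T r (fun x => if x = r then some a else none) :=
    TreeEmbedding.valid_root a
  have hmain := TreeEmbedding.one_sub_successProb_le_potential (l := 1 / 2)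
    (K := 2 * ε * d + 2) (D := d - 2 * ε * d - 2) hG hT hdeg (by norm_num)
    (by linarith [mul_nonneg hpos (Nat.cast_nonneg (α := ℝ) d)]) (by ring)
    (fun x => le_trans (by exact_mod_cast TreeEmbedding.card_children_le_maxDegree x) hmax)
    σ (Fintype.card U) [] _ hvalid hvalid.numUnembedded_lt.le
  rw [TreeEmbedding.potential_root] at hmain
  have hbound := hd₀ d hd _ (Nat.cast_nonneg T.edgeFinset.card) hcard
  rw [show (T.edgeFinset.card : ℝ) = Fintype.card U - 1 by linarith] at hbound
  have halg : ((TreeEmbedding.algorithm G T r a σ).toOuterMeasure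
      (TreeEmbedding.success G T)).toReal = TreeEmbedding.successProb G T r σ (Fintype.card U) []
        (fun x => if x = r then some a else none) := by
    rw [TreeEmbedding.successProb, TreeEmbedding.algorithm]
  rw [halg]
  refine sub_le_comm.mp (hmain.trans (le_of_eq_of_le ?_ hbound))
  ring
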